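/- A \emph{super von Neumann algebra} is a von Neumann algebra $A$ together with an ultraweakly continuous involutive $*$-automorphism $\gamma$; then $A = A^0\oplus A^1$ with $A^i=\{a: \gamma(a)=(-1)^i a\}$. Its \emph{graded center} is $\{a\in A : [a,b]=0 \text{ for all } b\in A\}$, where $[a,b]=ab-(-1)^{|a||b|}ba$ on homogeneous elements, extended bilinearly. $A$ is a \emph{super factor of type I} if it is nonzero, of type I as an ungraded von Neumann algebra, and its graded center equals $\mathbb{C}\cdot\mathbf{1}$. Such an $A$ is \emph{of even kind} if its ungraded center equals $\mathbb{C}\cdot\mathbf{1}$, and \emph{of odd kind} otherwise. \textbf{Theorem.} Let $A$ be a $\sigma$-finite super factor of type I, with grading automorphism $\gamma$. (i) If $A$ is of even kind, there are a separable complex Hilbert space $H$, a unitary $\Gamma$ on $H$ with $\Gamma^2=\mathbf{1}$, and a $*$-isomorphism $\varphi\colon A\to \mathrm{B}(H)$ with $\varphi(\gamma(a))=\Gamma\,\varphi(a)\,\Gamma^*$ for all $a\in A$. (ii) If $A$ is of odd kind, there are a separable complex Hilbert space $H$ and a $*$-isomorphism $\varphi\colon A\to \mathrm{B}(H)\oplus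 \mathrm{B}(H)$ such that, if $\varphi(a)=(x,y)$, then $\varphi(\gamma(a))=(y,x)$, for all $a\in A$. -/

import Mathlib

universe u

section SuperVonNeumann

variable (K : Type u) [NormedAddCommGroup K] [InnerProductSpace ℂ K] [CompleteSpace K]

/-- The ultraweak (σ-weak) topology on `B(K)`: the coarsest topology for which all functionals
`T ↦ ∑ₙ ⟪ξₙ, T ηₙ⟫` with `∑ₙ ‖ξₙ‖² < ∞` and `∑ₙ ‖ηₙ‖² < ∞` are continuous. -/
@[reducible] noncomputable def ultraweakTopology : TopologicalSpace (K →L[ℂ] K) :=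
  ⨅ (ξ : ℕ → K) (η : ℕ → K) (_ : Summable fun n => ‖ξ n‖ ^ 2) (_ : Summable fun n => ‖η n‖ ^ 2),
    TopologicalSpace.induced (fun T : K →L[ℂ] K => ∑' n, inner ℂ (ξ n) (T (η n))) inferInstance

/-- A super von Neumann algebra (acting on `K`): a von Neumann algebra together with a normal,
i.e. ultraweakly continuous, involutive *-automorphism. -/
structure SuperVonNeumannAlgebra extends VonNeumannAlgebra K where
  /-- The grading automorphism. -/
  grading : toStarSubalgebra ≃⋆ₐ[ℂ] toStarSubalgebra
  grading_involutive : Function.Involutive grading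
  grading_normal :
    @Continuous toStarSubalgebra toStarSubalgebra
      (TopologicalSpace.induced Subtype.val (ultraweakTopology K))
      (TopologicalSpace.induced Subtype.val (ultraweakTopology K)) grading

end SuperVonNeumann

namespace SuperVonNeumannAlgebra

variable {K : Type u} [NormedAddCommGroup K] [InnerProductSpace ℂ K] [CompleteSpace K]

/-- The underlying *-algebra of a super von Neumann algebra, as a type. -/
abbrev Carrier (A : SuperVonNeumannAlgebra K) : Type u := A.toStarSubalgebra

variable (A : SuperVonNeumannAlgebra K)

/-- The even component of an element. -/
noncomputable def evenPart (a : A.Carrier) : A.Carrier := (2⁻¹ : ℂ) • (a + A.grading a)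

/-- The odd component of an element. -/
noncomputable def oddPart (a : A.Carrier) : A.Carrier := (2⁻¹ : ℂ) • (a - A.grading a)

/-- The graded commutator: the bilinear extension of `[a, b] = ab - (-1)^(|a||b|) ba` from
homogeneous elements. -/
noncomputable def gradedCommutator (a b : A.Carrier) : A.Carrier :=
  (A.evenPart a * A.evenPart b - A.evenPart b * A.evenPart a)
    + (A.evenPart a * A.oddPart b - A.oddPart b * A.evenPart a)
    + (A.oddPart a * A.evenPart b - A.evenPart b * A.oddPart a)
    + (A.oddPart a * A.oddPart b + A.oddPart b * A.oddPart a)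

/-- The graded center. -/
def gradedCenter : Set A.Carrier := {a | ∀ b, A.gradedCommutator a b = 0}

/-- The ungraded center. -/
def ungradedCenter : Set A.Carrier := {a | ∀ b, a * b = b * a}

/-- The scalar multiples of the identity. -/
def scalars : Set A.Carrier := Set.range (algebraMap ℂ A.Carrier)

/-- A projection `e` is abelian if the corner `e A e` is commutative. -/
def IsAbelianProjection (e : A.Carrier) : Prop :=
  IsStarProjection e ∧ ∀ a b : A.Carrier, (e * a * e) * (e * b * e) = (e * b * e) * (e * a * e)

/-- The (ungraded) von Neumann algebra is of type I: every nonzero central projection `z`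
majorizes a nonzero abelian projection. -/
def IsTypeI : Prop :=
  ∀ z : A.Carrier, IsStarProjection z → z ∈ A.ungradedCenter → z ≠ 0 →
    ∃ e : A.Carrier, A.IsAbelianProjection e ∧ e ≠ 0 ∧ z * e = e

/-- The von Neumann algebra is σ-finite: every set of pairwise orthogonal nonzero projections in
it is countable. -/
def IsSigmaFinite : Prop :=
  ∀ S : Set A.Carrier, (∀ p ∈ S, IsStarProjection p ∧ p ≠ 0) →
    (S.Pairwise fun p q => p * q = 0) → S.Countable

/-- A super factor of type I: a super von Neumann algebra of type I (as an ungraded algebra)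
whose graded center is `ℂ` (in particular `1 ≠ 0`). -/
structure IsSuperFactorTypeI : Prop where
  nontrivial : Nontrivial A.Carrier
  typeI : A.IsTypeI
  gradedCenter_eq : A.gradedCenter = A.scalars

/-- Even kind: the ungraded center is trivial. -/
def IsEvenKind : Prop := A.ungradedCenter = A.scalars

/-- Odd kind: the ungraded center is not trivial. -/
def IsOddKind : Prop := ¬ A.IsEvenKind

end SuperVonNeumannAlgebra

/-! Everything is reduced to one minimal central projection `p`. In even kind `p = 1`; in odd kind
`p = (1 + u)/2`, where `u` is an odd central element with `u² = 1`, and the grading exchanges `p`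
and `1 - p`. Type I gives a nonzero abelian projection `e` below `p`, and minimality of `p` forces
`e M e = ℂ e` (`exists_corner_eq_smul`). For a unit vector `ξ` in the range of `e`, the map `a ↦ a
ξ` is isometric on `M e`, so the orbit `M ξ` is itself a Hilbert space `H`. The action of `M` on `H`
has kernel `{a | a p = 0}` and is onto `B(H)` (`orbitRep_surjective`); σ-finiteness makes `H`
separable. In even kind this action `φ` is an isomorphism. The grading becomes an involution of
`B(H)`, implemented by a unitary whose square is a scalar that can be normalised to `1`. In odd kind
`a ↦ (φ a, φ (γ a))` captures both central summands, and `γ` swaps the coordinates. -/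

namespace VonNeumannAlgebra

variable {K : Type u} [NormedAddCommGroup K] [InnerProductSpace ℂ K] [CompleteSpace K]
  {M : VonNeumannAlgebra K} {p e : K →L[ℂ] K} {ξ : K}

theorem smul_mem' (c : ℂ) {a : K →L[ℂ] K} (ha : a ∈ M) : c • a ∈ M :=
  M.toStarSubalgebra.smul_mem ha c

theorem mul_comm_of_mem_commutant {a b : K →L[ℂ] K} (ha : a ∈ M) (hb : b ∈ M.commutant) :
    a * b = b * a :=
  mem_commutant_iff.1 hb a ha

theorem apply_comm_of_mem_commutant {a b : K →L[ℂ] K} (ha : a ∈ M) (hb : b ∈ M.commutant)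
    (v : K) : a (b v) = b (a v) :=
  DFunLike.congr_fun (mul_comm_of_mem_commutant ha hb) v

theorem mem_of_commute_commutant {a : K →L[ℂ] K} (h : ∀ b ∈ M.commutant, b * a = a * b) :
    a ∈ M := by
  rw [← M.commutant_commutant]
  exact mem_commutant_iff.2 h

theorem isClosed_coe (M : VonNeumannAlgebra K) : IsClosed (M : Set (K →L[ℂ] K)) := by
  rw [← M.centralizer_centralizer]
  exact Set.isClosed_centralizer _

/-! ### Minimal central projections and the subspaces `[M M' ζ]`. -/

/-- Minimal nonzero central projections. -/
structure IsMinimalCentralProjection (M : VonNeumannAlgebra K) (p : K →L[ℂ] K) : Prop where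
  mem : p ∈ M
  isStarProjection : IsStarProjection p
  comm : ∀ b ∈ M, p * b = b * p
  minimal : ∀ z ∈ M, IsStarProjection z → (∀ b ∈ M, z * b = b * z) → p * z = z → z = 0 ∨ z = p

/-- The closed subspace generated by a vector under an algebra and its commutant. -/
noncomputable def bicyclicSubspace (M : VonNeumannAlgebra K) (ζ : K) : Submodule ℂ K :=
  (Submodule.span ℂ {w | ∃ a ∈ M, ∃ b ∈ M.commutant, w = a (b ζ)}).topologicalClosure

theorem bicyclicSubspace_le {ζ : K} {N : Submodule ℂ K} (hN : IsClosed (N : Set K))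
    (h : ∀ a ∈ M, ∀ b ∈ M.commutant, a (b ζ) ∈ N) : M.bicyclicSubspace ζ ≤ N := by
  refine Submodule.topologicalClosure_minimal _ (Submodule.span_le.2 ?_) hN
  rintro _ ⟨a, ha, b, hb, rfl⟩
  exact h a ha b hb

theorem apply_mem_bicyclicSubspace {a b : K →L[ℂ] K} (ha : a ∈ M) (hb : b ∈ M.commutant) (ζ : K) :
    a (b ζ) ∈ M.bicyclicSubspace ζ :=
  Submodule.le_topologicalClosure _ (Submodule.subset_span ⟨a, ha, b, hb, rfl⟩)

theorem self_mem_bicyclicSubspace (M : VonNeumannAlgebra K) (ζ : K) : ζ ∈ M.bicyclicSubspace ζ :=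
  apply_mem_bicyclicSubspace (one_mem M) (one_mem M.commutant) ζ

theorem isClosed_bicyclicSubspace (M : VonNeumannAlgebra K) (ζ : K) :
    IsClosed (M.bicyclicSubspace ζ : Set K) :=
  Submodule.isClosed_topologicalClosure _

namespace IsMinimalCentralProjection

variable (hp : M.IsMinimalCentralProjection p)
include hp

theorem mul_self : p * p = p := hp.isStarProjection.isIdempotentElem

/-- The part of the space below a minimal central projection is generated by each of its nonzero
vectors. -/
theorem apply_mem_bicyclicSubspace {ζ : K} (hζ : ζ ≠ 0) (hpζ : p ζ = ζ) (v : K) :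
    p v ∈ M.bicyclicSubspace ζ := by
  have hcl := M.isClosed_bicyclicSubspace ζ
  set N := M.bicyclicSubspace ζ
  have : CompleteSpace N := hcl.completeSpace_coe
  -- The space `N` is invariant under `M'` and under `M`, so its projection lies in `M` and in `M'`,
  -- i.e. it is central. It lies below `p` and fixes `ζ ≠ 0`, so by minimality it is `p`.
  have hQ : IsStarProjection N.starProjection := isStarProjection_starProjection
  have hQM : N.starProjection ∈ M := by
    rw [IsStarProjection.mem_iff hQ]
    intro y hy
    rw [Submodule.range_starProjection, Module.End.mem_invtSubmodule]
    refine bicyclicSubspace_le (hcl.preimage y.continuous) fun a ha b hb ↦ ?_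
    change y (a (b ζ)) ∈ N
    rw [← apply_comm_of_mem_commutant ha hy]
    exact VonNeumannAlgebra.apply_mem_bicyclicSubspace ha (mul_mem hy hb) ζ
  have hQM' : N.starProjection ∈ M.commutant := by
    rw [IsStarProjection.mem_iff hQ, commutant_commutant]
    intro y hy
    rw [Submodule.range_starProjection, Module.End.mem_invtSubmodule]
    exact bicyclicSubspace_le (hcl.preimage y.continuous) fun a ha b hb ↦
      VonNeumannAlgebra.apply_mem_bicyclicSubspace (mul_mem hy ha) hb ζ
  have hle : N ≤ LinearMap.ker ((p - 1 : K →L[ℂ] K) : K →ₗ[ℂ] K) := by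
    refine bicyclicSubspace_le (p - 1).isClosed_ker fun a ha b hb ↦ ?_
    have h1 : p (a (b ζ)) = a (p (b ζ)) := DFunLike.congr_fun (hp.comm a ha) _
    have h2 : p (b ζ) = b ζ := by rw [apply_comm_of_mem_commutant hp.mem hb, hpζ]
    simp [h1, h2]
  have hpQ : p * N.starProjection = N.starProjection := by
    ext w
    have := hle (Submodule.starProjection_apply_mem N w)
    simpa [sub_eq_zero] using this
  rcases hp.minimal _ hQM hQ (fun b hb ↦ (mem_commutant_iff.1 hQM' b hb).symm) hpQ with h | h
  · exfalso
    have : N.starProjection ζ = ζ :=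
      Submodule.starProjection_eq_self_iff.2 (M.self_mem_bicyclicSubspace ζ)
    rw [h] at this
    exact hζ this.symm
  · rw [← h]
    exact Submodule.starProjection_apply_mem N v

theorem mul_eq_zero {ζ : K} (hζ : ζ ≠ 0) (hpζ : p ζ = ζ) {x : K →L[ℂ] K}
    (hx : ∀ a ∈ M, ∀ b ∈ M.commutant, x (a (b ζ)) = 0) : x * p = 0 := by
  ext v
  exact bicyclicSubspace_le (N := LinearMap.ker (x : K →ₗ[ℂ] K)) x.isClosed_ker hx
    (hp.apply_mem_bicyclicSubspace hζ hpζ v)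

/-- Primeness of `M p`: a nonzero vector `y v` generates the range of `p` under `M` and `M'`, while
`x` kills every `a (b (y v)) = a (y (b v))`. -/
theorem eq_zero_or_eq_zero {x y : K →L[ℂ] K} (hy : y ∈ M) (hxp : x * p = x)
    (hyp : y * p = y) (h : ∀ a ∈ M, x * a * y = 0) : x = 0 ∨ y = 0 := by
  by_contra! hxy
  obtain ⟨v, hv⟩ : ∃ v, y v ≠ 0 := by
    by_contra! h0
    exact hxy.2 (ContinuousLinearMap.ext h0)
  have hpv : p (y v) = y v := by
    have := hp.comm y hy
    rw [hyp] at this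
    exact DFunLike.congr_fun this v
  refine hxy.1 (hxp ▸ hp.mul_eq_zero hv hpv fun a ha b hb ↦ ?_)
  rw [← apply_comm_of_mem_commutant hy hb]
  exact DFunLike.congr_fun (h a ha) (b v)

end IsMinimalCentralProjection

/-! ### Corners of abelian projections. -/

section Corner

theorem exists_apply_eq_self (he : IsStarProjection e) (he0 : e ≠ 0) : ∃ ξ : K, ‖ξ‖ = 1 ∧ e ξ = ξ := by
  obtain ⟨v, hv⟩ : ∃ v, e v ≠ 0 := by
    by_contra! h0
    exact he0 (ContinuousLinearMap.ext h0)
  have hev : e (e v) = e v := DFunLike.congr_fun he.isIdempotentElem v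
  exact ⟨(‖e v‖⁻¹ : ℂ) • e v, by simp [norm_smul, hv], by rw [map_smul, hev]⟩

theorem cfcₙ_real_mem {y : K →L[ℂ] K} (hy : y ∈ M) (f : ℝ → ℝ) : cfcₙ f y ∈ M := by
  refine mem_of_commute_commutant fun b hb ↦ ?_
  exact (Commute.cfcₙ_real (mul_comm_of_mem_commutant hy hb) f).eq.symm

theorem eq_zero_of_inner_eq_zero {y : K →L[ℂ] K} (hy : 0 ≤ y) {v : K}
    (h : inner ℂ v (y v) = 0) : y v = 0 := by
  obtain ⟨s, rfl⟩ := CStarAlgebra.nonneg_iff_eq_star_mul_self.1 hy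
  have hs : s v = 0 := by
    rw [mul_apply_eq_comp, ContinuousLinearMap.star_eq_adjoint,
      ContinuousLinearMap.adjoint_inner_right] at h
    exact inner_self_eq_zero.1 h
  simp [hs]

/-- Since `y y⁺ = (y⁺)²`, the factor `1 - e` kills `(y⁺)²`, and then `y⁺` by the C*-identity. -/
theorem mul_posPart_eq {y : K →L[ℂ] K} (hy : IsSelfAdjoint y)
    (hey : e * y = y) : e * y⁺ = y⁺ := by
  have h1 : y * y⁺ = y⁺ * y⁺ := by
    nth_rw 1 [← CFC.posPart_sub_negPart y hy]
    simp [sub_mul]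
  have h2 : (1 - e) * (y⁺ * y⁺) = 0 := by
    rw [← h1, ← mul_assoc, sub_mul, one_mul, hey, sub_self, zero_mul]
  have hpos : IsSelfAdjoint y⁺ := (CFC.posPart_nonneg y).isSelfAdjoint
  have h3 : (1 - e) * y⁺ = 0 := by
    rw [← CStarRing.mul_star_self_eq_zero_iff, star_mul, hpos.star_eq, mul_assoc, ← mul_assoc y⁺,
      ← mul_assoc, h2, zero_mul]
  rw [sub_mul, one_mul, sub_eq_zero] at h3
  exact h3.symm

theorem mul_negPart_eq {y : K →L[ℂ] K} (hy : IsSelfAdjoint y)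
    (hey : e * y = y) : e * y⁻ = y⁻ := by
  rw [← CFC.posPart_neg]
  exact mul_posPart_eq hy.neg (by rw [mul_neg, hey])

variable (hp : M.IsMinimalCentralProjection p) (heM : e ∈ M) (he : IsStarProjection e)
  (hpe : p * e = e)
  (hab : ∀ a ∈ M, ∀ b ∈ M, (e * a * e) * (e * b * e) = (e * b * e) * (e * a * e))
include hp heM he hpe hab

/-- Commutativity of the corner gives `y⁺ a y⁻ = (e a e) y⁺ y⁻ = 0` for all `a` in `M`, so primeness
kills `y⁺` or `y⁻`. -/
theorem nonneg_or_nonpos_of_corner {y : K →L[ℂ] K} (hyM : y ∈ M) (hy : IsSelfAdjoint y)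
    (hey : e * y = y) : 0 ≤ y ∨ 0 ≤ -y := by
  have hpos : IsSelfAdjoint y⁺ := (CFC.posPart_nonneg y).isSelfAdjoint
  have hneg : IsSelfAdjoint y⁻ := (CFC.negPart_nonneg y).isSelfAdjoint
  have e1 := mul_posPart_eq hy hey
  have e2 := mul_negPart_eq hy hey
  have e1' : y⁺ * e = y⁺ := by
    simpa [hpos.star_eq, he.isSelfAdjoint.star_eq] using congr(star $e1)
  have e2' : y⁻ * e = y⁻ := by
    simpa [hneg.star_eq, he.isSelfAdjoint.star_eq] using congr(star $e2)
  have hep : e * p = e := by rw [← hp.comm e heM, hpe]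
  have m1 : y⁺ ∈ M := cfcₙ_real_mem hyM _
  have m2 : y⁻ ∈ M := cfcₙ_real_mem hyM _
  have key : ∀ a ∈ M, y⁺ * a * y⁻ = 0 := by
    intro a ha
    have := hab _ m1 a ha
    rw [e1, e1'] at this
    calc y⁺ * a * y⁻ = y⁺ * (e * a * e) * y⁻ := by
          conv_lhs => rw [← e1', ← e2]
          simp only [mul_assoc]
      _ = 0 := by rw [this, mul_assoc, CFC.posPart_mul_negPart, mul_zero]
  have hsub := CFC.posPart_sub_negPart y hy
  rcases hp.eq_zero_or_eq_zero m2 (by rw [← e1', mul_assoc, hep]) (by rw [← e2', mul_assoc, hep])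
    key with h | h
  · right
    rw [← hsub, h, zero_sub, neg_neg]
    exact CFC.negPart_nonneg y
  · left
    rw [← hsub, h, sub_zero]
    exact CFC.posPart_nonneg y

/-- Take `c = ⟪ξ, x ξ⟫` for a unit vector `ξ` fixed by `e`. Then `y = x - c e` has a definite sign
and `⟪ξ, y ξ⟫ = 0`, so `y ξ = 0`; commutation of `y` with `e a e` spreads this to all of `M M' ξ`,
which generates the range of `p`. -/
theorem eq_smul_of_corner_of_isSelfAdjoint {x : K →L[ℂ] K} (hxM : x ∈ M) (hx : IsSelfAdjoint x)
    (hex : e * x = x) : ∃ c : ℂ, x = c • e := by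
  by_cases he0 : e = 0
  · exact ⟨0, by rw [← hex, he0]; simp⟩
  obtain ⟨ξ, hξ, heξ⟩ := exists_apply_eq_self he he0
  have hxe : x * e = x := by
    simpa [hx.star_eq, he.isSelfAdjoint.star_eq] using congr(star $hex)
  have hep : e * p = e := by rw [← hp.comm e heM, hpe]
  have hreal : (starRingEnd ℂ) (inner ℂ ξ (x ξ)) = inner ℂ ξ (x ξ) := by
    rw [inner_conj_symm, ← ContinuousLinearMap.adjoint_inner_right,
      ← ContinuousLinearMap.star_eq_adjoint, hx.star_eq]
  set c : ℂ := inner ℂ ξ (x ξ) with hc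
  refine ⟨c, sub_eq_zero.1 ?_⟩
  set y := x - c • e with hy
  have hyM : y ∈ M := sub_mem hxM (smul_mem' c heM)
  have hys : IsSelfAdjoint y := by
    rw [isSelfAdjoint_iff, hy, star_sub, star_smul, hx.star_eq, he.isSelfAdjoint.star_eq]
    rw [← hreal]; simp
    rw [hreal]
  have hey : e * y = y := by
    rw [hy, mul_sub, hex, mul_smul_comm, he.isIdempotentElem.eq]
  have hye : y * e = y := by
    rw [hy, sub_mul, hxe, smul_mul_assoc, he.isIdempotentElem.eq]
  have hin : inner ℂ ξ (y ξ) = 0 := by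
    simp [hy, heξ, hξ, ← hc]
  have hyξ : y ξ = 0 := by
    rcases nonneg_or_nonpos_of_corner hp heM he hpe hab hyM hys hey with h | h
    · exact eq_zero_of_inner_eq_zero h hin
    · have := eq_zero_of_inner_eq_zero h (v := ξ) (by simp [hin])
      simpa using this
  have hξ0 : ξ ≠ 0 := by rintro rfl; simp at hξ
  have hpξ : p ξ = ξ := by
    rw [← heξ]; exact DFunLike.congr_fun hpe ξ
  have := hp.mul_eq_zero hξ0 hpξ (x := y) fun a ha b hb ↦ by
    have h1 := hab a ha y hyM
    rw [hey, hye] at h1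
    have h2 := DFunLike.congr_fun h1 ξ
    simp only [mul_apply_eq_comp, hyξ, map_zero, heξ] at h2
    rw [apply_comm_of_mem_commutant ha hb, apply_comm_of_mem_commutant hyM hb]
    have h3 : y (e (a ξ)) = y (a ξ) := DFunLike.congr_fun hye (a ξ)
    rw [h3] at h2
    rw [← h2, map_zero]
  rwa [← hye, mul_assoc, hep, hye] at this

/-- The corner of an abelian projection below a minimal central projection is one-dimensional. -/
theorem exists_corner_eq_smul {a : K →L[ℂ] K} (ha : a ∈ M) : ∃ c : ℂ, e * a * e = c • e := by
  have key : ∀ b ∈ M, IsSelfAdjoint b → ∃ c : ℂ, e * b * e = c • e := by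
    intro b hb hbs
    refine eq_smul_of_corner_of_isSelfAdjoint hp heM he hpe hab (mul_mem (mul_mem heM hb) heM) ?_ ?_
    · rw [isSelfAdjoint_iff]
      simp [hbs.star_eq, he.isSelfAdjoint.star_eq, mul_assoc]
    · simp only [← mul_assoc, he.isIdempotentElem.eq]
  obtain ⟨c, hc⟩ := key (a + star a) (add_mem ha (star_mem ha)) (IsSelfAdjoint.add_star_self a)
  obtain ⟨d, hd⟩ := key (Complex.I • (a - star a)) (smul_mem' _ (sub_mem ha (star_mem ha))) (by
    rw [isSelfAdjoint_iff]
    simp [← smul_neg])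
  refine ⟨2⁻¹ * (c - Complex.I * d), ?_⟩
  have : a = (2⁻¹ : ℂ) • ((a + star a) - Complex.I • (Complex.I • (a - star a))) := by
    rw [smul_smul, Complex.I_mul_I]
    module
  rw [this]
  rw [mul_smul_comm, smul_mul_assoc, mul_sub, sub_mul, hc, mul_smul_comm, smul_mul_assoc, hd]
  module

end Corner

end VonNeumannAlgebra

/-! ### The representation on the orbit of a vector. -/

namespace VonNeumannAlgebra

variable {K : Type u} [NormedAddCommGroup K] [InnerProductSpace ℂ K] [CompleteSpace K]
  {M : VonNeumannAlgebra K} {p e : K →L[ℂ] K} {ξ : K}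

instance (M : VonNeumannAlgebra K) : IsClosed (M.toStarSubalgebra : Set (K →L[ℂ] K)) :=
  M.isClosed_coe

/-- A projection `e` whose corner consists of scalars, with a unit vector in its range. -/
structure IsRankOneCorner (M : VonNeumannAlgebra K) (e : K →L[ℂ] K) (ξ : K) : Prop where
  mem : e ∈ M
  isStarProjection : IsStarProjection e
  corner : ∀ a ∈ M, ∃ c : ℂ, e * a * e = c • e
  apply_eq : e ξ = ξ
  norm_eq : ‖ξ‖ = 1

/-- The orbit of a vector under a von Neumann algebra. -/
def orbit (M : VonNeumannAlgebra K) (ξ : K) : Submodule ℂ K where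
  carrier := {v | ∃ a ∈ M, a ξ = v}
  add_mem' := by
    rintro _ _ ⟨a, ha, rfl⟩ ⟨b, hb, rfl⟩
    exact ⟨a + b, add_mem ha hb, rfl⟩
  zero_mem' := ⟨0, zero_mem M, rfl⟩
  smul_mem' := by
    rintro c _ ⟨a, ha, rfl⟩
    exact ⟨c • a, smul_mem' c ha, rfl⟩

theorem apply_mem_orbit {a : K →L[ℂ] K} (ha : a ∈ M) {v : K} (hv : v ∈ M.orbit ξ) :
    a v ∈ M.orbit ξ := by
  obtain ⟨b, hb, rfl⟩ := hv
  exact ⟨a * b, mul_mem ha hb, rfl⟩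

namespace IsRankOneCorner

variable (h : M.IsRankOneCorner e ξ)
include h

theorem mul_self : e * e = e := h.isStarProjection.isIdempotentElem

theorem star_eq : star e = e := h.isStarProjection.isSelfAdjoint.star_eq

theorem inner_self : inner ℂ ξ ξ = (1 : ℂ) := by simp [h.norm_eq]

theorem ne_zero : ξ ≠ 0 := by
  rintro rfl
  simpa using h.norm_eq

theorem corner_eq {a : K →L[ℂ] K} (ha : a ∈ M) : e * a * e = (inner ℂ ξ (a ξ) : ℂ) • e := by
  obtain ⟨c, hc⟩ := h.corner a ha
  have h1 : e (a (e ξ)) = c • e ξ := DFunLike.congr_fun hc ξ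
  rw [h.apply_eq] at h1
  have h2 : (inner ℂ ξ (e (a ξ)) : ℂ) = inner ℂ ξ (a ξ) := by
    rw [← ContinuousLinearMap.adjoint_inner_left, ← ContinuousLinearMap.star_eq_adjoint, h.star_eq,
      h.apply_eq]
  rw [hc, ← h2, h1, inner_smul_right, h.inner_self, mul_one]

/-- Inner products of orbit vectors are thereby read off inside `M`: orthonormal vectors correspond
to partial isometries with orthogonal ranges. -/
theorem star_mul_eq {a b : K →L[ℂ] K} (ha : a ∈ M) (hb : b ∈ M) (hae : a * e = a)
    (hbe : b * e = b) : star a * b = (inner ℂ (a ξ) (b ξ) : ℂ) • e := by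
  have h1 := h.corner_eq (mul_mem (star_mem ha) hb)
  have h2 : e * star a = star a := by
    rw [← h.star_eq, ← star_mul, hae]
  rw [← mul_assoc, h2, mul_assoc, hbe] at h1
  rw [h1, mul_apply_eq_comp, ContinuousLinearMap.star_eq_adjoint,
    ContinuousLinearMap.adjoint_inner_right]

theorem exists_of_mem_orbit {v : K} (hv : v ∈ M.orbit ξ) : ∃ a ∈ M, a * e = a ∧ a ξ = v := by
  obtain ⟨a, ha, rfl⟩ := hv
  refine ⟨a * e, mul_mem ha h.mem, by rw [mul_assoc, h.mul_self], ?_⟩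
  rw [mul_apply_eq_comp, h.apply_eq]

theorem norm_apply {a : K →L[ℂ] K} (ha : a ∈ M) (hae : a * e = a) : ‖a ξ‖ = ‖a‖ := by
  have h1 := h.star_mul_eq ha ha hae hae
  have he1 : ‖e‖ = 1 := by
    have h2 : ‖e‖ * ‖e‖ = ‖e‖ := by
      conv_rhs => rw [← h.mul_self]
      conv_rhs => enter [1, 1]; rw [← h.star_eq]
      exact CStarRing.norm_star_mul_self.symm
    have h3 : ‖e‖ ≠ 0 := by
      intro h0
      have h4 := h.apply_eq
      rw [norm_eq_zero.1 h0] at h4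
      exact h.ne_zero h4.symm
    exact mul_left_cancel₀ h3 (by rw [h2, mul_one])
  have h2 : ‖a‖ * ‖a‖ = ‖a ξ‖ * ‖a ξ‖ := by
    rw [← CStarRing.norm_star_mul_self, h1, norm_smul, he1, mul_one, inner_self_eq_norm_sq_to_K]
    simp [pow_two]
  exact (mul_self_inj (norm_nonneg _) (norm_nonneg _)).1 h2.symm

/-- The orbit is the isometric image of the norm-closed left ideal `M e`, so no completion is
needed. -/
theorem isClosed_orbit : IsClosed (M.orbit ξ : Set K) := by
  let L : Submodule ℂ (K →L[ℂ] K) :=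
    { carrier := {a | a ∈ M ∧ a * e = a}
      add_mem' := fun ha hb ↦ ⟨add_mem ha.1 hb.1, by rw [add_mul, ha.2, hb.2]⟩
      zero_mem' := ⟨zero_mem M, zero_mul e⟩
      smul_mem' := fun c a ha ↦ ⟨VonNeumannAlgebra.smul_mem' c ha.1, by rw [smul_mul_assoc, ha.2]⟩ }
  have hL : IsClosed (L : Set (K →L[ℂ] K)) :=
    M.isClosed_coe.inter (isClosed_eq (by fun_prop) continuous_id)
  have : CompleteSpace L := hL.completeSpace_coe
  let f : L →ₗᵢ[ℂ] K :=
    { toFun := fun a ↦ (a : K →L[ℂ] K) ξ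
      map_add' := fun _ _ ↦ rfl
      map_smul' := fun _ _ ↦ rfl
      norm_map' := fun a ↦ h.norm_apply a.2.1 a.2.2 }
  convert f.isometry.isClosedEmbedding.isClosed_range
  ext v
  constructor
  · intro hv
    obtain ⟨a, ha, hae, rfl⟩ := h.exists_of_mem_orbit hv
    exact ⟨⟨a, ha, hae⟩, rfl⟩
  · rintro ⟨a, rfl⟩
    exact ⟨a, a.2.1, rfl⟩

end IsRankOneCorner

/-- The representation of a von Neumann algebra on the orbit of a vector. -/
noncomputable def orbitRep (M : VonNeumannAlgebra K) (ξ : K) [CompleteSpace (M.orbit ξ)] :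
    M.toStarSubalgebra →⋆ₐ[ℂ] (M.orbit ξ →L[ℂ] M.orbit ξ) where
  toFun a := (a : K →L[ℂ] K).restrict fun _ hv ↦ apply_mem_orbit a.2 hv
  map_one' := rfl
  map_mul' _ _ := rfl
  map_zero' := rfl
  map_add' _ _ := rfl
  commutes' _ := rfl
  map_star' a := by
    rw [ContinuousLinearMap.star_eq_adjoint, ContinuousLinearMap.eq_adjoint_iff]
    intro x y
    change inner ℂ ((star (a : K →L[ℂ] K)) (x : K)) (y : K) = inner ℂ (x : K) ((a : K →L[ℂ] K) y)
    rw [ContinuousLinearMap.star_eq_adjoint, ContinuousLinearMap.adjoint_inner_left]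

theorem IsRankOneCorner.central_apply_eq (h : M.IsRankOneCorner e ξ) (hpe : p * e = e) :
    p ξ = ξ := by
  conv_lhs => rw [← h.apply_eq]
  rw [← mul_apply_eq_comp, hpe, h.apply_eq]

section Rep

variable [CompleteSpace (M.orbit ξ)]

@[simp]
theorem coe_orbitRep_apply (a : M.toStarSubalgebra) (v : M.orbit ξ) :
    (M.orbitRep ξ a v : K) = (a : K →L[ℂ] K) v :=
  rfl

variable (hp : M.IsMinimalCentralProjection p) (h : M.IsRankOneCorner e ξ) (hpe : p * e = e)
include hp h hpe

theorem orbitRep_eq_zero_iff {a : M.toStarSubalgebra} :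
    M.orbitRep ξ a = 0 ↔ (a : K →L[ℂ] K) * p = 0 := by
  have hpξ := h.central_apply_eq hpe
  constructor
  · intro ha
    refine hp.mul_eq_zero h.ne_zero hpξ fun b hb c hc ↦ ?_
    rw [apply_comm_of_mem_commutant hb hc, apply_comm_of_mem_commutant a.2 hc]
    have := congr(((($ha) ⟨b ξ, b, hb, rfl⟩ : M.orbit ξ) : K))
    rw [coe_orbitRep_apply] at this
    rw [this]
    exact map_zero c
  · intro ha
    ext ⟨v, b, hb, rfl⟩
    have h1 : p (b ξ) = b ξ := by
      rw [← mul_apply_eq_comp, hp.comm b hb, mul_apply_eq_comp, hpξ]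
    have h2 := DFunLike.congr_fun ha (b ξ)
    rw [mul_apply_eq_comp, h1] at h2
    exact h2

theorem norm_orbitRep {a : M.toStarSubalgebra} (ha : (a : K →L[ℂ] K) * p = a) :
    ‖M.orbitRep ξ a‖ = ‖a‖ := by
  let q : K →L[ℂ] K := 1 - p
  have hq : q * q = q := by simp [q, mul_sub, sub_mul, hp.mul_self]
  have hqs : star q = q := by simp [q, hp.isStarProjection.isSelfAdjoint.star_eq]
  have hqc : ∀ b ∈ M, q * b = b * q := fun b hb ↦ by simp [q, mul_sub, sub_mul, hp.comm b hb]
  -- The representation is faithful only on `M p`. Adding the summand `b (1 - p)` gives an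
  -- injective, hence isometric, *-homomorphism whose second coordinate vanishes at `a`.
  let ψ : M.toStarSubalgebra →⋆ₙₐ[ℂ] (M.orbit ξ →L[ℂ] M.orbit ξ) × (K →L[ℂ] K) :=
    { toFun := fun b ↦ (M.orbitRep ξ b, (b : K →L[ℂ] K) * q)
      map_smul' := fun c b ↦ by ext1 <;> simp
      map_zero' := by ext1 <;> simp
      map_add' := fun b c ↦ by ext1 <;> simp [add_mul]
      map_mul' := fun b c ↦ by
        ext1
        · simp
        · change (b : K →L[ℂ] K) * c * q = b * q * (c * q)
          rw [← mul_assoc, mul_assoc (b : K →L[ℂ] K) q c, hqc _ c.2]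
          simp only [mul_assoc, hq]
      map_star' := fun b ↦ by
        ext1
        · exact map_star (M.orbitRep ξ) b
        · change star (b : K →L[ℂ] K) * q = star ((b : K →L[ℂ] K) * q)
          rw [star_mul, hqs, hqc _ (star_mem (show (b : K →L[ℂ] K) ∈ M from b.2))] }
  have hinj : Function.Injective ψ := by
    rw [injective_iff_map_eq_zero]
    intro b hb
    have h1 : M.orbitRep ξ b = 0 := congr(($hb).1)
    have h2 : (b : K →L[ℂ] K) * (1 - p) = 0 := congr(($hb).2)
    rw [orbitRep_eq_zero_iff hp h hpe] at h1
    rw [mul_sub, h1, sub_zero, mul_one] at h2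
    exact Subtype.ext h2
  rw [← NonUnitalStarAlgHom.norm_map ψ hinj a]
  change _ = ‖(M.orbitRep ξ a, (a : K →L[ℂ] K) * (1 - p))‖
  rw [mul_sub, ha, mul_one, sub_self, Prod.norm_mk, norm_zero]
  exact (max_eq_left (norm_nonneg (M.orbitRep ξ a))).symm

end Rep

end VonNeumannAlgebra

/-! ### Pointwise limits and Hilbert bases. -/

open Filter Topology

section PointwiseLimit

variable {ι E F : Type*} [NormedAddCommGroup E] [NormedSpace ℂ E]
  [NormedAddCommGroup F] [NormedSpace ℂ F] [CompleteSpace F]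

/-- The subspace of pointwise convergence of a family of continuous linear maps. -/
def convergenceSubspace (l : Filter ι) (g : ι → E →L[ℂ] F) : Submodule ℂ E where
  carrier := {v | ∃ w, Tendsto (fun i ↦ g i v) l (𝓝 w)}
  add_mem' := by
    rintro x y ⟨v, hv⟩ ⟨w, hw⟩
    exact ⟨v + w, by simpa using hv.add hw⟩
  zero_mem' := ⟨0, by simpa using tendsto_const_nhds⟩
  smul_mem' := by
    rintro c x ⟨v, hv⟩
    exact ⟨c • v, by simpa using hv.const_smul c⟩

theorem isClosed_convergenceSubspace (l : Filter ι) [l.NeBot] (g : ι → E →L[ℂ] F) {C : ℝ}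
    (hg : ∀ i, ‖g i‖ ≤ C) : IsClosed (convergenceSubspace l g : Set E) := by
  refine isClosed_of_closure_subset fun v hv ↦ ?_
  refine cauchy_map_iff_exists_tendsto.1 (Metric.cauchy_iff.2 ⟨inferInstance, fun ε hε ↦ ?_⟩)
  obtain ⟨i₀⟩ := l.nonempty_of_neBot
  have hC : 0 ≤ C := (norm_nonneg _).trans (hg i₀)
  -- The `+ 1` keeps the denominator nonzero when `C = 0`.
  obtain ⟨w, ⟨x, hx⟩, hvw⟩ := Metric.mem_closure_iff.1 hv (ε / (4 * (C + 1))) (by positivity)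
  have hsmall : ∀ i, dist (g i v) (g i w) < ε / 4 := by
    intro i
    rw [dist_eq_norm, ← map_sub]
    calc ‖g i (v - w)‖ ≤ C * ‖v - w‖ := (g i).le_of_opNorm_le (hg i) _
      _ ≤ (C + 1) * ‖v - w‖ := by gcongr; linarith
      _ < (C + 1) * (ε / (4 * (C + 1))) := by
          rw [← dist_eq_norm]; gcongr
      _ = ε / 4 := by field_simp
  refine ⟨_, image_mem_map (Metric.tendsto_nhds.1 hx (ε / 4) (by positivity)), ?_⟩
  rintro _ ⟨i, hi, rfl⟩ _ ⟨j, hj, rfl⟩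
  have h1 := hsmall i
  have h2 := hsmall j
  have hi : dist (g i w) x < ε / 4 := hi
  have hj : dist (g j w) x < ε / 4 := hj
  rw [dist_comm] at h2 hj
  have := dist_triangle4 (g i v) (g i w) x (g j w)
  have := dist_triangle (g i v) (g j w) (g j v)
  linarith

end PointwiseLimit

theorem HilbertBasis.norm_sum_inner_smul_le {ι H : Type*} [NormedAddCommGroup H]
    [InnerProductSpace ℂ H] (b : HilbertBasis ι ℂ H) (F : Finset ι) (v : H) :
    ‖∑ i ∈ F, inner ℂ (b i) v • b i‖ ≤ ‖v‖ := by
  refine (sq_le_sq₀ (norm_nonneg _) (norm_nonneg _)).1 ?_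
  refine le_trans (le_of_eq ?_) (b.orthonormal.sum_inner_products_le (s := F) v)
  rw [← RCLike.ofReal_inj (K := ℂ), RCLike.ofReal_pow, ← inner_self_eq_norm_sq_to_K,
    b.orthonormal.inner_sum]
  simp only [RCLike.conj_mul]
  simp

theorem HilbertBasis.hasSum_inner_smul {ι H : Type*} [NormedAddCommGroup H]
    [InnerProductSpace ℂ H] (b : HilbertBasis ι ℂ H) (v : H) :
    HasSum (fun i ↦ inner ℂ (b i) v • b i) v := by
  simpa only [b.repr_apply_apply] using b.hasSum_repr v

theorem HilbertBasis.separableSpace {ι H : Type*} [Countable ι] [NormedAddCommGroup H]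
    [InnerProductSpace ℂ H] (b : HilbertBasis ι ℂ H) : TopologicalSpace.SeparableSpace H := by
  have h : TopologicalSpace.IsSeparable (Set.univ : Set H) := by
    have := ((Set.countable_range b).isSeparable.span (R := ℂ)).closure
    rwa [← Submodule.topologicalClosure_coe, b.dense_span, Submodule.top_coe] at this
  exact TopologicalSpace.isSeparable_univ_iff.1 h

/-! ### Separability of the orbit and surjectivity of the representation. -/

namespace VonNeumannAlgebra

variable {K : Type u} [NormedAddCommGroup K] [InnerProductSpace ℂ K] [CompleteSpace K]
  {M : VonNeumannAlgebra K} {p e : K →L[ℂ] K} {ξ : K}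

namespace IsRankOneCorner

/-- If `a i ξ = b i` with `a i ∈ M e`, the `a i (a i)*` are nonzero, pairwise orthogonal projections
of `M`, so σ-finiteness bounds the index set. -/
theorem countable_of_hilbertBasis (h : M.IsRankOneCorner e ξ)
    (hσ : ∀ S : Set (K →L[ℂ] K), (∀ q ∈ S, q ∈ M ∧ IsStarProjection q ∧ q ≠ 0) →
      (S.Pairwise fun q r ↦ q * r = 0) → S.Countable)
    {ι : Type*} (b : HilbertBasis ι ℂ (M.orbit ξ)) : Countable ι := by
  choose a ha hae haξ using fun i ↦ h.exists_of_mem_orbit (b i).2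
  have horth : ∀ i j, i ≠ j → star (a i) * a j = 0 := by
    intro i j hij
    rw [h.star_mul_eq (ha i) (ha j) (hae i) (hae j), haξ, haξ, ← Submodule.coe_inner,
      b.orthonormal.2 hij, zero_smul]
  have hself : ∀ i, star (a i) * a i = e := by
    intro i
    rw [h.star_mul_eq (ha i) (ha i) (hae i) (hae i), haξ, ← Submodule.coe_inner,
      inner_self_eq_norm_sq_to_K, b.orthonormal.1 i]
    simp
  have hne : ∀ i, a i * star (a i) ≠ 0 := by
    intro i h0
    rw [CStarRing.mul_star_self_eq_zero_iff] at h0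
    have h1 := haξ i
    rw [h0] at h1
    have h2 := b.orthonormal.1 i
    rw [Submodule.coe_norm, ← h1] at h2
    simp at h2
  have hmul : ∀ i j, i ≠ j → a i * star (a i) * (a j * star (a j)) = 0 := by
    intro i j hij
    rw [mul_assoc, ← mul_assoc (star (a i)), horth i j hij, zero_mul, mul_zero]
  have hidem : ∀ i, a i * star (a i) * (a i * star (a i)) = a i * star (a i) := by
    intro i
    rw [mul_assoc, ← mul_assoc (star (a i)), hself, ← mul_assoc, hae]
  have hinj : Function.Injective fun i ↦ a i * star (a i) := by
    intro i j hij
    by_contra hne'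
    have h1 := hmul i j hne'
    rw [← show a i * star (a i) = a j * star (a j) from hij, hidem] at h1
    exact hne i h1
  have := hσ (Set.range fun i ↦ a i * star (a i)) (by
    rintro _ ⟨i, rfl⟩
    exact ⟨mul_mem (ha i) (star_mem (ha i)), ⟨hidem i, IsSelfAdjoint.mul_star_self _⟩, hne i⟩) (by
    rintro _ ⟨i, rfl⟩ _ ⟨j, rfl⟩ hij
    exact hmul i j fun h ↦ hij (by rw [h]))
  exact Set.countable_univ_iff.1 ((Set.countable_of_injective_of_countable_image hinj.injOn)
    (by rwa [Set.image_univ]))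

/-- On the orbit, `c i (a i)*` is the rank-one operator sending `b i` to `T (b i)`. The partial sums
represent `T` cut down to finitely many basis vectors and are bounded by `‖T‖`, since the
representation is isometric on `M p`. They converge on `M' M ξ`, hence strongly everywhere, and the
limit commutes with `M'`. -/
theorem orbitRep_surjective [CompleteSpace (M.orbit ξ)] (hp : M.IsMinimalCentralProjection p)
    (h : M.IsRankOneCorner e ξ) (hpe : p * e = e)
    {ι : Type*} [Countable ι] (b : HilbertBasis ι ℂ (M.orbit ξ)) :
    Function.Surjective (M.orbitRep ξ) := by
  intro T
  have hpξ := h.central_apply_eq hpe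
  choose a ha hae haξ using fun i ↦ h.exists_of_mem_orbit (b i).2
  choose c hc hce hcξ using fun i ↦ h.exists_of_mem_orbit (T (b i)).2
  let x : Finset ι → K →L[ℂ] K := fun F ↦ ∑ i ∈ F, c i * star (a i)
  have hxM : ∀ F, x F ∈ M := fun F ↦ sum_mem fun i _ ↦ mul_mem (hc i) (star_mem (ha i))
  have hxp : ∀ F, x F * p = x F := by
    intro F
    rw [Finset.sum_mul]
    refine Finset.sum_congr rfl fun i _ ↦ ?_
    have h1 : p * a i = a i := by
      rw [← hae i, ← mul_assoc, hp.comm _ (ha i), mul_assoc, hpe]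
    have h2 : star (a i) * p = star (a i) := by
      rw [← hp.isStarProjection.isSelfAdjoint.star_eq, ← star_mul, h1]
    rw [mul_assoc, h2]
  have hxv : ∀ F (v : M.orbit ξ),
      x F v = (T (∑ i ∈ F, inner ℂ (b i) v • b i) : M.orbit ξ) := by
    rintro F ⟨v, hv⟩
    obtain ⟨d, hd, hde, rfl⟩ := h.exists_of_mem_orbit hv
    simp only [x, map_sum, map_smul, sum_apply, Submodule.coe_sum,
      Submodule.coe_smul, Submodule.coe_inner]
    refine Finset.sum_congr rfl fun i _ ↦ ?_
    rw [← mul_apply_eq_comp, mul_assoc, h.star_mul_eq (ha i) hd (hae i) hde, mul_smul_comm, hce,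
      haξ, ← hcξ]
    rfl
  have hlim : ∀ v : M.orbit ξ, Tendsto (fun F ↦ x F v) atTop (𝓝 (T v : K)) := by
    intro v
    simp only [hxv]
    exact ((continuous_subtype_val.comp T.continuous).tendsto v).comp (b.hasSum_inner_smul v)
  have hbound : ∀ F, ‖x F‖ ≤ ‖T‖ := by
    intro F
    have h1 := norm_orbitRep hp h hpe (a := ⟨x F, hxM F⟩) (hxp F)
    have h2 : ‖M.orbitRep ξ ⟨x F, hxM F⟩‖ ≤ ‖T‖ := by
      refine ContinuousLinearMap.opNorm_le_bound _ (norm_nonneg T) fun v ↦ ?_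
      rw [Submodule.coe_norm, coe_orbitRep_apply, hxv, ← Submodule.coe_norm]
      exact (T.le_opNorm _).trans (by gcongr; exact b.norm_sum_inner_smul_le F v)
    rwa [h1] at h2
  have hconv : ∀ v : K, ∃ w, Tendsto (fun F ↦ x F v) atTop (𝓝 w) := by
    intro v
    have hle : M.bicyclicSubspace ξ ≤ convergenceSubspace atTop x := by
      refine bicyclicSubspace_le (isClosed_convergenceSubspace atTop x hbound) fun d hd f hf ↦ ?_
      refine ⟨f (T ⟨d ξ, d, hd, rfl⟩ : M.orbit ξ), ?_⟩
      have h1 := (f.continuous.tendsto _).comp (hlim ⟨d ξ, d, hd, rfl⟩)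
      refine h1.congr fun F ↦ ?_
      rw [apply_comm_of_mem_commutant hd hf, apply_comm_of_mem_commutant (hxM F) hf]
      rfl
    obtain ⟨w, hw⟩ := hle (hp.apply_mem_bicyclicSubspace h.ne_zero hpξ v)
    refine ⟨w, hw.congr fun F ↦ ?_⟩
    rw [← mul_apply_eq_comp, hxp]
  choose f hf using hconv
  let X : K →L[ℂ] K := continuousLinearMapOfTendsto x (tendsto_pi_nhds.2 hf)
  have hX : ∀ v, Tendsto (fun F ↦ x F v) atTop (𝓝 (X v)) := hf
  have hXM : X ∈ M := by
    refine mem_of_commute_commutant fun y hy ↦ ?_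
    ext v
    refine tendsto_nhds_unique ((y.continuous.tendsto _).comp (hX v)) ((hX (y v)).congr fun F ↦ ?_)
    exact apply_comm_of_mem_commutant (hxM F) hy v
  refine ⟨⟨X, hXM⟩, ?_⟩
  ext v
  exact tendsto_nhds_unique (hX v) (hlim v)

end IsRankOneCorner

/-- The quotient of a σ-finite von Neumann algebra by a minimal central projection majorizing a
nonzero abelian projection is the algebra of all bounded operators on a separable Hilbert space. -/
theorem exists_surjective_starAlgHom (hp : M.IsMinimalCentralProjection p)
    (heM : e ∈ M) (he : IsStarProjection e) (he0 : e ≠ 0) (hpe : p * e = e)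
    (hab : ∀ a ∈ M, ∀ b ∈ M, (e * a * e) * (e * b * e) = (e * b * e) * (e * a * e))
    (hσ : ∀ S : Set (K →L[ℂ] K), (∀ q ∈ S, q ∈ M ∧ IsStarProjection q ∧ q ≠ 0) →
      (S.Pairwise fun q r ↦ q * r = 0) → S.Countable) :
    ∃ (H : Type u) (_ : NormedAddCommGroup H) (_ : InnerProductSpace ℂ H) (_ : CompleteSpace H)
      (_ : TopologicalSpace.SeparableSpace H) (φ : M.toStarSubalgebra →⋆ₐ[ℂ] (H →L[ℂ] H)),
      Function.Surjective φ ∧ ∀ a, φ a = 0 ↔ (a : K →L[ℂ] K) * p = 0 := by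
  obtain ⟨ξ, hξ, heξ⟩ := exists_apply_eq_self he he0
  have h : M.IsRankOneCorner e ξ :=
    ⟨heM, he, fun a ha ↦ exists_corner_eq_smul hp heM he hpe hab ha, heξ, hξ⟩
  have : CompleteSpace (M.orbit ξ) := h.isClosed_orbit.completeSpace_coe
  obtain ⟨w, b, -⟩ := exists_hilbertBasis ℂ (M.orbit ξ)
  have := h.countable_of_hilbertBasis hσ b
  exact ⟨M.orbit ξ, inferInstance, inferInstance, inferInstance, b.separableSpace, M.orbitRep ξ,
    h.orbitRep_surjective hp hpe b, fun a ↦ orbitRep_eq_zero_iff hp h hpe⟩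

end VonNeumannAlgebra

/-! ### The center of a super factor. -/

namespace SuperVonNeumannAlgebra

variable {K : Type u} [NormedAddCommGroup K] [InnerProductSpace ℂ K] [CompleteSpace K]
  {A : SuperVonNeumannAlgebra K}

theorem coe_isStarProjection_iff {a : A.Carrier} :
    IsStarProjection (a : K →L[ℂ] K) ↔ IsStarProjection a := by
  simp only [isStarProjection_iff, IsIdempotentElem, isSelfAdjoint_iff, Subtype.ext_iff]
  rfl

theorem IsSigmaFinite.countable (hσ : A.IsSigmaFinite) (S : Set (K →L[ℂ] K))
    (hS : ∀ q ∈ S, q ∈ A.toVonNeumannAlgebra ∧ IsStarProjection q ∧ q ≠ 0)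
    (h : S.Pairwise fun q r ↦ q * r = 0) : S.Countable := by
  have h1 : (Subtype.val ⁻¹' S : Set A.Carrier).Countable := by
    refine hσ _ (fun p hp ↦ ?_) fun p hp q hq hpq ↦ Subtype.ext (h hp hq fun h ↦ hpq (Subtype.ext h))
    obtain ⟨-, h1, h2⟩ := hS _ hp
    exact ⟨coe_isStarProjection_iff.1 h1, fun h ↦ h2 congr(($h).1)⟩
  refine (h1.image Subtype.val).mono fun q hq ↦ ?_
  exact ⟨(⟨q, (hS q hq).1⟩ : A.Carrier), hq, rfl⟩

theorem exists_surjective_starAlgHom (hσ : A.IsSigmaFinite) (hI : A.IsTypeI) {p : A.Carrier}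
    (hp0 : p ≠ 0) (hp : IsStarProjection p) (hpc : p ∈ A.ungradedCenter)
    (hmin : ∀ z : A.Carrier, IsStarProjection z → z ∈ A.ungradedCenter → p * z = z →
      z = 0 ∨ z = p) :
    ∃ (H : Type u) (_ : NormedAddCommGroup H) (_ : InnerProductSpace ℂ H) (_ : CompleteSpace H)
      (_ : TopologicalSpace.SeparableSpace H) (φ : A.Carrier →⋆ₐ[ℂ] (H →L[ℂ] H)),
      Function.Surjective φ ∧ ∀ a, φ a = 0 ↔ a * p = 0 := by
  obtain ⟨e, ⟨he, hab⟩, he0, hpe⟩ := hI p hp hpc hp0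
  have hp' : A.toVonNeumannAlgebra.IsMinimalCentralProjection (p : K →L[ℂ] K) :=
    { mem := p.2
      isStarProjection := coe_isStarProjection_iff.2 hp
      comm := fun b hb ↦ congr(($(hpc ⟨b, hb⟩)).1)
      minimal := fun z hz hzp hzc hpz ↦ by
        refine (hmin ⟨z, hz⟩ (coe_isStarProjection_iff.1 hzp)
          (fun b ↦ Subtype.ext (hzc b b.2)) (Subtype.ext hpz)).imp (fun h ↦ ?_) fun h ↦ ?_ <;>
        exact congr(($h).1) }
  obtain ⟨H, i1, i2, i3, i4, φ, hφ, hker⟩ := VonNeumannAlgebra.exists_surjective_starAlgHom hp' e.2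
    (coe_isStarProjection_iff.2 he) (fun h ↦ he0 (Subtype.ext h)) congr(($hpe).1)
    (fun a ha b hb ↦ congr(($(hab ⟨a, ha⟩ ⟨b, hb⟩)).1)) hσ.countable
  exact ⟨H, i1, i2, i3, i4, φ, hφ, fun a ↦ (hker a).trans ⟨fun h ↦ Subtype.ext h, fun h ↦ congr(($h).1)⟩⟩

theorem one_mem_ungradedCenter : (1 : A.Carrier) ∈ A.ungradedCenter := fun b ↦ by simp

theorem grading_grading (a : A.Carrier) : A.grading (A.grading a) = a := A.grading_involutive a

theorem grading_mem_ungradedCenter {z : A.Carrier} (hz : z ∈ A.ungradedCenter) :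
    A.grading z ∈ A.ungradedCenter := fun b ↦ by
  rw [← A.grading_grading b, ← map_mul, ← map_mul, hz]

theorem eq_zero_or_one_of_mem_scalars {z : A.Carrier} (hz : z ∈ A.scalars)
    (hzp : IsIdempotentElem z) : z = 0 ∨ z = 1 := by
  obtain ⟨c, rfl⟩ := hz
  by_cases h : Nontrivial A.Carrier
  · have h1 : algebraMap ℂ A.Carrier (c * c) = algebraMap ℂ A.Carrier c := by
      rw [map_mul]; exact hzp
    have h2 : IsIdempotentElem c := (algebraMap ℂ A.Carrier).injective h1
    rcases IsIdempotentElem.iff_eq_zero_or_one.1 h2 with rfl | rfl <;> simp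
  · rw [not_nontrivial_iff_subsingleton] at h
    exact Or.inl (Subsingleton.elim _ _)

/-- Even central elements lie in the graded center. -/
theorem mem_gradedCenter_of_grading_eq {z : A.Carrier} (hz : z ∈ A.ungradedCenter)
    (h : A.grading z = z) : z ∈ A.gradedCenter := by
  intro b
  have h1 : A.evenPart z = z := by rw [evenPart, h]; module
  have h2 : A.oddPart z = 0 := by rw [oddPart, h, sub_self, smul_zero]
  simp [gradedCommutator, h1, h2, hz _]

theorem mul_self_ne_zero_of_mem_ungradedCenter {d : A.Carrier} (hd : d ∈ A.ungradedCenter)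
    (h0 : d ≠ 0) : d * d ≠ 0 := by
  intro h
  have h1 : star (star d * d) * (star d * d) = 0 := by
    rw [star_mul, star_star, mul_assoc, ← mul_assoc d, hd (star d), mul_assoc, h]
    simp
  rw [CStarRing.star_mul_self_eq_zero_iff, CStarRing.star_mul_self_eq_zero_iff] at h1
  exact h0 h1

/-- In odd kind, the center contains an odd element of square one. -/
theorem exists_odd_central (hA : A.gradedCenter = A.scalars) (hodd : A.IsOddKind) :
    ∃ u ∈ A.ungradedCenter, A.grading u = -u ∧ u * u = 1 := by
  obtain ⟨z, hz, hzs⟩ : ∃ z ∈ A.ungradedCenter, z ∉ A.scalars := by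
    by_contra! h
    refine hodd (Set.Subset.antisymm h ?_)
    rintro _ ⟨c, rfl⟩ b
    exact Algebra.commutes c b
  let d := z - A.grading z
  have hdc : d ∈ A.ungradedCenter := fun b ↦ by
    simp only [d, sub_mul, mul_sub, hz b, grading_mem_ungradedCenter hz b]
  have hd : A.grading d = -d := by simp [d, grading_grading]
  -- If `d = 0`, then `z` is even and central, hence in the graded center and scalar.
  have hd0 : d ≠ 0 := fun h ↦
    hzs (hA ▸ mem_gradedCenter_of_grading_eq hz (sub_eq_zero.1 h).symm)
  have hdd : d * d ∈ A.scalars := by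
    rw [← hA]
    refine mem_gradedCenter_of_grading_eq (fun b ↦ ?_) (by rw [map_mul, hd, neg_mul_neg])
    rw [mul_assoc, hdc b, ← mul_assoc, hdc b, mul_assoc]
  obtain ⟨c, hc⟩ := hdd
  have hc0 : c ≠ 0 := by
    rintro rfl
    exact mul_self_ne_zero_of_mem_ungradedCenter hdc hd0 (by rw [← hc, map_zero])
  obtain ⟨m, hm⟩ := IsAlgClosed.exists_pow_nat_eq c⁻¹ (n := 2) (by norm_num)
  refine ⟨m • d, fun b ↦ ?_, by rw [map_smul, hd, smul_neg], ?_⟩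
  · rw [smul_mul_assoc, mul_smul_comm, hdc b]
  · rw [smul_mul_smul_comm, ← hc, ← pow_two, hm, Algebra.algebraMap_eq_smul_one, smul_smul,
      inv_mul_cancel₀ hc0, one_smul]

/-- In odd kind, the center contains a minimal projection which the grading exchanges with its
complement. -/
theorem exists_central_projection (hA : A.IsSuperFactorTypeI) (hodd : A.IsOddKind) :
    ∃ p : A.Carrier, p ≠ 0 ∧ IsStarProjection p ∧ p ∈ A.ungradedCenter ∧ A.grading p = 1 - p ∧
      ∀ z : A.Carrier, IsStarProjection z → z ∈ A.ungradedCenter → p * z = z → z = 0 ∨ z = p := by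
  have := hA.nontrivial
  obtain ⟨u, huc, hu, huu⟩ := exists_odd_central hA.gradedCenter_eq hodd
  let p : A.Carrier := (2⁻¹ : ℂ) • (1 + u)
  have hpc : p ∈ A.ungradedCenter := fun b ↦ by
    simp [p, add_mul, mul_add, huc b]
  have hpp : p * p = p := by
    simp only [p, smul_mul_smul_comm, mul_add, add_mul, huu, one_mul, mul_one]
    module
  have hp : IsStarProjection p := by
    rw [← coe_isStarProjection_iff]
    have h1 : IsIdempotentElem (p : K →L[ℂ] K) := congr(($hpp).1)
    -- A central idempotent is normal, hence self-adjoint; thus `u` need not be chosen self-adjoint.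
    refine ⟨h1, (ContinuousLinearMap.IsIdempotentElem.isSelfAdjoint_iff_isStarNormal h1).2 ⟨?_⟩⟩
    exact congr(($(hpc (star p))).1).symm
  have hgp : A.grading p = 1 - p := by
    simp only [p, map_smul, map_add, map_one, hu]
    module
  refine ⟨p, fun h ↦ ?_, hp, hpc, hgp, fun z hz hzc hpz ↦ ?_⟩
  · rw [h, map_zero, sub_zero] at hgp
    exact zero_ne_one hgp
  -- The sum `z + γ z` is even and central, hence a scalar `c`. Since `γ z` lies below `1 - p`,
  -- multiplying by `p` leaves `z = c p`.
  · have h1 : z + A.grading z ∈ A.scalars := by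
      rw [← hA.gradedCenter_eq]
      refine mem_gradedCenter_of_grading_eq (fun b ↦ ?_) (by
        rw [map_add, grading_grading, add_comm])
      rw [add_mul, mul_add, hzc b, grading_mem_ungradedCenter hzc b]
    have h2 : A.grading z = (1 - p) * A.grading z := by rw [← hgp, ← map_mul, hpz]
    have h3 : p * A.grading z = 0 := by
      rw [h2, ← mul_assoc, mul_sub, mul_one, hpp, sub_self, zero_mul]
    obtain ⟨c, hc⟩ := h1
    have h4 : z = c • p := by
      have : p * (z + A.grading z) = z := by rw [mul_add, h3, hpz, add_zero]
      rw [← this, ← hc, Algebra.algebraMap_eq_smul_one, mul_smul_comm, mul_one]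
    have h5 : (c * c - c) • p = 0 := by
      have := hz.isIdempotentElem.eq
      rw [h4, smul_mul_smul_comm, hpp] at this
      rw [sub_smul, this, sub_self]
    rcases smul_eq_zero.1 h5 with h6 | h6
    · rcases IsIdempotentElem.iff_eq_zero_or_one.1 (sub_eq_zero.1 h6) with rfl | rfl
      · left; rw [h4, zero_smul]
      · right; rw [h4, one_smul]
    · left; rw [h4, h6, smul_zero]

end SuperVonNeumannAlgebra

/-! ### Involutions of `B(H)` and the final assembly. -/

/-- An involutive `*`-automorphism of the algebra of all bounded operators on a Hilbert space is
implemented by a self-adjoint unitary. -/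
theorem StarAlgEquiv.exists_involutive_unitary {H : Type*} [NormedAddCommGroup H]
    [InnerProductSpace ℂ H] [CompleteSpace H] (α : (H →L[ℂ] H) ≃⋆ₐ[ℂ] (H →L[ℂ] H))
    (hα : Function.Involutive α) :
    ∃ Γ ∈ unitary (H →L[ℂ] H), Γ * Γ = 1 ∧ ∀ T, α T = Γ * T * star Γ := by
  obtain ⟨U, hU⟩ := α.eq_linearIsometryEquivConjStarAlgEquiv (StarAlgEquiv.isometry α).continuous
  have h2 : (U.trans U).conjStarAlgEquiv = (LinearIsometryEquiv.refl ℂ H).conjStarAlgEquiv := by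
    rw [LinearIsometryEquiv.conjStarAlgEquiv_trans, ← hU]
    ext1 T
    exact hα T
  obtain ⟨c, hc⟩ := (LinearIsometryEquiv.conjStarAlgEquiv_ext_iff _ _).1 h2
  -- As `U²` implements the identity, it is a scalar `c`; rescaling `U` by `m` with `m² = c⁻¹` makes
  -- the square `1`.
  obtain ⟨m, hm⟩ := IsAlgClosed.exists_pow_nat_eq ((c : ℂ)⁻¹) (n := 2) (by norm_num)
  have hc1 : ‖(c : ℂ)‖ = 1 := CStarRing.norm_coe_unitary c
  have hc0 : (c : ℂ) ≠ 0 := by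
    intro h
    simp [h] at hc1
  have hm1 : ‖m‖ = 1 := by
    have h3 := congr(‖$hm‖)
    rw [norm_pow, norm_inv, hc1, inv_one] at h3
    exact (pow_eq_one_iff_of_nonneg (norm_nonneg m) two_ne_zero).1 h3
  have hmm : m * star m = 1 := by
    rw [← starRingEnd_apply, RCLike.mul_conj, hm1]
    simp
  let W : H →L[ℂ] H := (U : H →L[ℂ] H)
  let V : H →L[ℂ] H := (U.symm : H →L[ℂ] H)
  have hWV : W * V = 1 := by ext v; exact U.apply_symm_apply v
  have hVW : V * W = 1 := by ext v; exact U.symm_apply_apply v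
  have hstar : star W = V := by
    rw [ContinuousLinearMap.star_eq_adjoint]
    exact LinearIsometryEquiv.adjoint_eq_symm U
  have hWW : W * W = (c : ℂ) • 1 := by
    ext v
    exact DFunLike.congr_fun hc v
  have hst : star (m • W) = star m • V := by rw [star_smul, hstar]
  refine ⟨m • W, Unitary.mem_iff.2 ⟨?_, ?_⟩, ?_, fun T ↦ ?_⟩
  · rw [hst, smul_mul_smul_comm, hVW, mul_comm, hmm, one_smul]
  · rw [hst, smul_mul_smul_comm, hWV, hmm, one_smul]
  · rw [smul_mul_smul_comm, hWW, ← pow_two, hm, smul_smul, inv_mul_cancel₀ hc0, one_smul]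
  · rw [hst, smul_mul_assoc, smul_mul_smul_comm, hmm, one_smul, hU]
    rfl

theorem mainTheorem9 {K : Type u} [NormedAddCommGroup K] [InnerProductSpace ℂ K] [CompleteSpace K]
    (A : SuperVonNeumannAlgebra K) (hσ : A.IsSigmaFinite) (hA : A.IsSuperFactorTypeI) :
    (A.IsEvenKind →
      ∃ (H : Type u) (_ : NormedAddCommGroup H) (_ : InnerProductSpace ℂ H) (_ : CompleteSpace H)
        (_ : TopologicalSpace.SeparableSpace H) (Γ : H →L[ℂ] H) (φ : A.Carrier ≃⋆ₐ[ℂ] (H →L[ℂ] H)),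
        Γ ∈ unitary (H →L[ℂ] H) ∧ Γ * Γ = 1 ∧
          ∀ a : A.Carrier, φ (A.grading a) = Γ * φ a * star Γ) ∧
    (A.IsOddKind →
      ∃ (H : Type u) (_ : NormedAddCommGroup H) (_ : InnerProductSpace ℂ H) (_ : CompleteSpace H)
        (_ : TopologicalSpace.SeparableSpace H)
        (φ : A.Carrier ≃⋆ₐ[ℂ] (H →L[ℂ] H) × (H →L[ℂ] H)),
        ∀ a : A.Carrier, φ (A.grading a) = (φ a).swap) := by
  have := hA.nontrivial
  refine ⟨fun heven ↦ ?_, fun hodd ↦ ?_⟩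
  · obtain ⟨H, i1, i2, i3, i4, φ, hφ, hker⟩ := SuperVonNeumannAlgebra.exists_surjective_starAlgHom
      hσ hA.typeI (p := 1) one_ne_zero (.one _)
      SuperVonNeumannAlgebra.one_mem_ungradedCenter fun z hz hzc _ ↦
        SuperVonNeumannAlgebra.eq_zero_or_one_of_mem_scalars (heven ▸ hzc) hz.isIdempotentElem
    have hinj : Function.Injective φ :=
      (injective_iff_map_eq_zero φ).2 fun a ha ↦ by simpa using (hker a).1 ha
    let Φ : A.Carrier ≃⋆ₐ[ℂ] (H →L[ℂ] H) := StarAlgEquiv.ofBijective φ ⟨hinj, hφ⟩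
    let α := (Φ.symm.trans A.grading).trans Φ
    have hα : ∀ T, α T = Φ (A.grading (Φ.symm T)) := fun _ ↦ rfl
    obtain ⟨Γ, hΓ, hΓΓ, h⟩ := α.exists_involutive_unitary fun T ↦ by
      rw [hα, hα, StarAlgEquiv.symm_apply_apply, A.grading_grading, StarAlgEquiv.apply_symm_apply]
    refine ⟨H, i1, i2, i3, i4, Γ, Φ, hΓ, hΓΓ, fun a ↦ ?_⟩
    rw [← h, hα, StarAlgEquiv.symm_apply_apply]
  · obtain ⟨p, hp0, hp, hpc, hgp, hmin⟩ :=
      SuperVonNeumannAlgebra.exists_central_projection hA hodd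
    obtain ⟨H, i1, i2, i3, i4, φ, hφ, hker⟩ :=
      SuperVonNeumannAlgebra.exists_surjective_starAlgHom hσ hA.typeI hp0 hp hpc hmin
    have hpp : p * p = p := hp.isIdempotentElem
    have hφp : φ p = 1 := by
      have : φ (1 - p) = 0 := by rw [hker, sub_mul, one_mul, hpp, sub_self]
      rw [map_sub, map_one, sub_eq_zero] at this
      exact this.symm
    let ψ : A.Carrier →⋆ₐ[ℂ] (H →L[ℂ] H) × (H →L[ℂ] H) :=
      φ.prod (φ.comp (A.grading : A.Carrier →⋆ₐ[ℂ] A.Carrier))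
    have hψ : ∀ a, ψ a = (φ a, φ (A.grading a)) := fun _ ↦ rfl
    have hinj : Function.Injective ψ := by
      refine (injective_iff_map_eq_zero ψ).2 fun a ha ↦ ?_
      rw [hψ, Prod.mk_eq_zero, hker, hker] at ha
      have h1 : a * (1 - p) = 0 := by
        rw [← A.grading_grading a, ← hgp, ← map_mul, ha.2, map_zero]
      rw [mul_sub, ha.1, mul_one, sub_zero] at h1
      exact h1
    have hsurj : Function.Surjective ψ := by
      rintro ⟨x, y⟩
      obtain ⟨a, rfl⟩ := hφ x
      obtain ⟨b, rfl⟩ := hφ y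
      -- Since `φ p = 1` and `φ (γ p) = 0`, the first summand maps to `(φ a, 0)` and the second to
      -- `(0, φ b)`.
      refine ⟨p * a + A.grading (p * b), ?_⟩
      rw [hψ]
      simp [hgp, hφp, A.grading_grading]
    refine ⟨H, i1, i2, i3, i4, StarAlgEquiv.ofBijective ψ ⟨hinj, hsurj⟩, fun a ↦ ?_⟩
    change ψ (A.grading a) = (ψ a).swap
    rw [hψ, hψ, A.grading_grading]
    rfl
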